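/- \textbf{Definitions.} A \emph{subordination} between boolean algebras $A$ and $B$ is a relation $S\subseteq A\times B$ such that $0\mathrel{S}0$ and $1\mathrel{S}1$; $a,b\mathrel{S}c$ implies $(a\vee b)\mathrel{S}c$; $a\mathrel{S}c,d$ implies $a\mathrel{S}(c\wedge d)$; and $a\le b\mathrel{S}c\le d$ implies $a\mathrel{S}d$. An \emph{$\mathsf{S5}$-subordination algebra} $(B,S)$ is a boolean algebra $B$ with a subordination $S\subseteq B\times B$ such that $a\mathrel{S}b$ implies $a\le b$, $\neg b\mathrel{S}\neg a$, and $a\mathrel{S}c\mathrel{S}b$ for some $c\in B$. It is a \emph{de Vries algebra} if moreover $B$ is complete and for each $a\ne 0$ there is $b\neq 0$ with $b\mathrel{S}a$. $\mathsf{SubS5^S}$ is the category of $\mathsf{S5}$-subordination algebras, whose morphisms $(B_1,S_1)\to(B_2,S_2)$ are the compatible subordinations, i.e. the subordinations $T\subseteq B_1\times B_2$ with $S_2\circ T=T=T\circ S_1$; composition is relation composition and the identity of $(B,S)$ is $S$. $\mathsf{DeV^S}$ is its full subcategory of de Vries algebras, and $\Delta\colon\mathsf{DeV^S}\to\mathsf{SubS5^S}$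 is the inclusion. For such a $T$ let $\widehat T\subseteq B_2\times B_1$ be given by $b\mathrel{\widehat T}a$ iff $\neg a\mathrel{T}\neg b$; $T$ is \emph{functional} if $\widehat T\circ T\subseteq S_1$ and $S_2\subseteq T\circ\widehat T$. $\mathsf{SubS5^F}$ and $\mathsf{DeV^F}$ are the wide subcategories of $\mathsf{SubS5^S}$ and $\mathsf{DeV^S}$ whose morphisms are the functional ones. In a frame, $a\prec b$ means $a^*\vee b=1$, where $a^*$ is the pseudocomplement of $a$. A frame is \emph{compact} if $1$ is a compact element and \emph{regular} if $a=\bigvee\{x\mid x\prec a\}$ for each $a$. $\mathsf{KRFrm^P}$ is the category of compact regular frames and preframe homomorphisms (maps preserving finite meets and directed joins), and $\mathsf{KRFrm}$ is its wide subcategory whose morphisms are the frame homomorphisms (maps preserving finite meets and arbitrary joins). For an $\mathsf{S5}$-subordination algebra $\mathbf B=(B,S)$, let $\mathcal{RI}(\mathbf B)$ be the frame, ordered by inclusion, of round ideals of $\mathbf B$, i.e. ideals $I$ of $B$ such that each $a\in I$ satisfies $a\mathrel{S}b$ for some $b\in I$; for a morphism $T\colon\mathbf B_1\to\mathbf B_2$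 of $\mathsf{SubS5^S}$ let $\mathcal{RI}(T)(I)=T^{-1}[I]$. For a compact regular frame $L$, let $\mathfrak B L=\{a\in L\mid a=a^{**}\}$ with the restriction of $\prec$; for a preframe homomorphism $\Box\colon L\to M$ let $b\mathrel{\mathfrak B(\Box)}a$ iff $b\prec\Box a$, for $b\in\mathfrak BM$ and $a\in\mathfrak BL$. Then $\mathcal{RI}\colon\mathsf{SubS5^S}\to\mathsf{KRFrm^P}$ and $\mathfrak B\colon\mathsf{KRFrm^P}\to\mathsf{DeV^S}$ are contravariant functors. The functors $\mathcal{RI}$ and $\Delta\circ\mathfrak B$, with the natural isomorphisms $Q_{\mathbf B}\colon\mathbf B\to\mathfrak B\,\mathcal{RI}(\mathbf B)$, $a\mathrel{Q_{\mathbf B}}I$ iff $a\in I$, and $f_L\colon L\to\mathcal{RI}(\mathfrak BL)$, $f_L(a)=\{b\in\mathfrak BL\mid b\prec a\}$, form a dual equivalence between $\mathsf{SubS5^S}$ and $\mathsf{KRFrm^P}$; likewise $\mathcal{RI}\circ\Delta$ and $\mathfrak B$ form a dual equivalence between $\mathsf{DeV^S}$ and $\mathsf{KRFrm^P}$. \textbf{Theorem.}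 (1) The dual equivalence between $\mathsf{SubS5^S}$ and $\mathsf{KRFrm^P}$ formed by $\mathcal{RI}$ and $\Delta\circ\mathfrak B$ restricts to a dual equivalence between their wide subcategories $\mathsf{SubS5^F}$ and $\mathsf{KRFrm}$. (2) The dual equivalence between $\mathsf{DeV^S}$ and $\mathsf{KRFrm^P}$ formed by $\mathcal{RI}\circ\Delta$ and $\mathfrak B$ restricts to a dual equivalence between their wide subcategories $\mathsf{DeV^F}$ and $\mathsf{KRFrm}$. Here ``restricts'' means that the contravariant functors and the natural isomorphisms of the dual equivalence between the wide subcategories are the restrictions of those of the given dual equivalence. -/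

import Mathlib

open CategoryTheory

universe u

/-! ### S5-subordination algebras and compatible subordinations -/

/-- A relation `S` between boolean algebras is a subordination. -/
structure IsSubordination {A B : Type u} [BooleanAlgebra A] [BooleanAlgebra B]
    (S : A → B → Prop) : Prop where
  bot_bot : S ⊥ ⊥
  top_top : S ⊤ ⊤
  sup_left : ∀ {a b : A} {c : B}, S a c → S b c → S (a ⊔ b) c
  inf_right : ∀ {a : A} {c d : B}, S a c → S a d → S a (c ⊓ d)
  mono : ∀ {a b : A} {c d : B}, a ≤ b → S b c → c ≤ d → S a d

/-- An S5-subordination algebra: a boolean algebra with an S5-subordination `rel` on it. -/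
structure SubS5S : Type (u + 1) where
  carrier : Type u
  [str : BooleanAlgebra carrier]
  rel : carrier → carrier → Prop
  isSubordination : IsSubordination rel
  le_of_rel : ∀ {a b : carrier}, rel a b → a ≤ b
  compl_rel_compl : ∀ {a b : carrier}, rel a b → rel bᶜ aᶜ
  exists_between : ∀ {a b : carrier}, rel a b → ∃ c, rel a c ∧ rel c b

attribute [instance] SubS5S.str

/-- Compatible subordinations `T : (B₁, S₁) → (B₂, S₂)`, i.e. `S₂ ∘ T = T = T ∘ S₁`. Note that
`Relation.Comp T S` relates `a` to `c` iff there is `b` with `T a b` and `S b c`, so that it is the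
composite relation `S ∘ T`. -/
@[ext]
structure CompatSub (B₁ B₂ : SubS5S.{u}) : Type u where
  rel : B₁.carrier → B₂.carrier → Prop
  isSubordination : IsSubordination rel
  comp_right : Relation.Comp rel B₂.rel = rel
  comp_left : Relation.Comp B₁.rel rel = rel

namespace CompatSub

variable {B₁ B₂ B₃ B₄ : SubS5S.{u}}

theorem right (T : CompatSub B₁ B₂) {a : B₁.carrier} {b : B₂.carrier} :
    T.rel a b ↔ ∃ c, T.rel a c ∧ B₂.rel c b := by
  conv_lhs => rw [← T.comp_right]
  rfl

theorem left (T : CompatSub B₁ B₂) {a : B₁.carrier} {b : B₂.carrier} :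
    T.rel a b ↔ ∃ c, B₁.rel a c ∧ T.rel c b := by
  conv_lhs => rw [← T.comp_left]
  rfl

/-- The identity morphism on `(B, S)` is `S`. -/
def id (B : SubS5S.{u}) : CompatSub B B where
  rel := B.rel
  isSubordination := B.isSubordination
  comp_right := by
    ext a b
    exact ⟨fun ⟨c, h, h'⟩ => B.isSubordination.mono (B.le_of_rel h) h' le_rfl,
      fun h => B.exists_between h⟩
  comp_left := by
    ext a b
    exact ⟨fun ⟨c, h, h'⟩ => B.isSubordination.mono (B.le_of_rel h) h' le_rfl,
      fun h => B.exists_between h⟩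

/-- Composition of morphisms is composition of relations. -/
def comp (T : CompatSub B₁ B₂) (U : CompatSub B₂ B₃) : CompatSub B₁ B₃ where
  rel := Relation.Comp T.rel U.rel
  isSubordination :=
    { bot_bot := ⟨⊥, T.isSubordination.bot_bot, U.isSubordination.bot_bot⟩
      top_top := ⟨⊤, T.isSubordination.top_top, U.isSubordination.top_top⟩
      sup_left := fun ⟨x, h, h'⟩ ⟨y, k, k'⟩ =>
        ⟨x ⊔ y, T.isSubordination.sup_left (T.isSubordination.mono le_rfl h le_sup_left)
          (T.isSubordination.mono le_rfl k le_sup_right), U.isSubordination.sup_left h' k'⟩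
      inf_right := fun ⟨x, h, h'⟩ ⟨y, k, k'⟩ =>
        ⟨x ⊓ y, T.isSubordination.inf_right h k, U.isSubordination.inf_right
          (U.isSubordination.mono inf_le_left h' le_rfl)
          (U.isSubordination.mono inf_le_right k' le_rfl)⟩
      mono := fun h ⟨x, k, k'⟩ h' =>
        ⟨x, T.isSubordination.mono h k le_rfl, U.isSubordination.mono le_rfl k' h'⟩ }
  comp_right := by rw [Relation.comp_assoc, U.comp_right]
  comp_left := by rw [← Relation.comp_assoc, T.comp_left]

end CompatSub

/-- The category of S5-subordination algebras and compatible subordinations. -/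
instance SubS5S.category : Category.{u} SubS5S.{u} where
  Hom := CompatSub
  id := CompatSub.id
  comp := CompatSub.comp
  id_comp T := CompatSub.ext T.comp_left
  comp_id T := CompatSub.ext T.comp_right
  assoc _ _ _ := CompatSub.ext Relation.comp_assoc

/-- De Vries algebras: `(B, S)` satisfies the compingent law and `B` is complete. -/
def isDeVries : ObjectProperty SubS5S.{u} := fun B =>
  (∀ a : B.carrier, a ≠ ⊥ → ∃ b : B.carrier, b ≠ ⊥ ∧ B.rel b a) ∧
    ∀ s : Set B.carrier, ∃ x, IsLUB s x

/-- The full subcategory of de Vries algebras. -/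
abbrev DeVS : Type (u + 1) := isDeVries.{u}.FullSubcategory

/-! ### Functional morphisms -/

/-- The relation `T̂` given by `b T̂ a` iff `¬a T ¬b`. -/
def hat {A B : Type u} [BooleanAlgebra A] [BooleanAlgebra B] (T : A → B → Prop) : B → A → Prop :=
  fun b a => T aᶜ bᶜ

/-- A morphism `T` is functional if `T̂ ∘ T ⊆ S₁` and `S₂ ⊆ T ∘ T̂`. -/
def functional : MorphismProperty SubS5S.{u} := fun B₁ B₂ T =>
  (∀ a a' : B₁.carrier, Relation.Comp (CompatSub.rel T) (hat (CompatSub.rel T)) a a' →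
      B₁.rel a a') ∧
    ∀ b b' : B₂.carrier, B₂.rel b b' →
      Relation.Comp (hat (CompatSub.rel T)) (CompatSub.rel T) b b'

instance functional_isMultiplicative : functional.{u}.IsMultiplicative where
  id_mem B := by
    refine ⟨fun a a' ⟨c, h, h'⟩ => ?_, fun b b' h => ?_⟩
    · have h'' := B.compl_rel_compl h'
      rw [compl_compl, compl_compl] at h''
      exact B.isSubordination.mono (B.le_of_rel h) h'' le_rfl
    · obtain ⟨c, h, h'⟩ := B.exists_between h
      exact ⟨c, B.compl_rel_compl h, h'⟩
  comp_mem {B₁ B₂ B₃} T U hT hU := by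
    refine ⟨fun a a' ⟨y, ⟨x, h, h'⟩, ⟨x', k', k⟩⟩ => ?_, fun b b' h => ?_⟩
    · have hx : B₂.rel x x'ᶜ := hU.1 x x'ᶜ ⟨y, h', by simpa [hat] using k⟩
      refine hT.1 a a' ⟨x'ᶜ, (CompatSub.right T).2 ⟨x, h, hx⟩, by simpa [hat] using k'⟩
    · obtain ⟨x, hx, hx'⟩ := hU.2 _ _ h
      obtain ⟨x₁, h₁, h₂⟩ := (CompatSub.left U).1 hx'
      obtain ⟨y, hy, hy'⟩ := hT.2 _ _ h₁
      exact ⟨y, ⟨xᶜ, hy, hx⟩, ⟨x₁, hy', h₂⟩⟩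

/-- The wide subcategory of functional morphisms. -/
abbrev SubS5F : Type (u + 1) := WideSubcategory functional.{u}

/-- The wide subcategory of functional morphisms between de Vries algebras. -/
abbrev DeVF : Type (u + 1) :=
  WideSubcategory (functional.{u}.inverseImage isDeVries.{u}.ι)

/-! ### Compact regular frames -/

/-- `a` is well inside `b`. -/
def WellInside {L : Type u} [Order.Frame L] (a b : L) : Prop := aᶜ ⊔ b = ⊤

/-- Compact regular frames. -/
structure KRFrmP : Type (u + 1) where
  carrier : Type u
  [str : Order.Frame carrier]
  isCompact : IsCompactElement (⊤ : carrier)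
  isRegular : ∀ a : carrier, a = sSup {x | WellInside x a}

attribute [instance] KRFrmP.str

/-- Preframe homomorphisms: maps that preserve finite meets and directed joins. -/
@[ext]
structure PreframeHom (L M : KRFrmP.{u}) : Type u where
  toFun : L.carrier → M.carrier
  map_top : toFun ⊤ = ⊤
  map_inf : ∀ a b, toFun (a ⊓ b) = toFun a ⊓ toFun b
  map_sSup : ∀ s : Set L.carrier, s.Nonempty → DirectedOn (· ≤ ·) s →
    toFun (sSup s) = sSup (toFun '' s)

theorem PreframeHom.monotone {L M : KRFrmP.{u}} (f : PreframeHom L M) : Monotone f.toFun := by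
  intro a b h
  rw [← inf_eq_left, ← f.map_inf, inf_eq_left.2 h]

theorem DirectedOn.image_mono {A B : Type u} [Preorder A] [Preorder B] {s : Set A}
    (hs : DirectedOn (· ≤ ·) s) {f : A → B} (hf : Monotone f) : DirectedOn (· ≤ ·) (f '' s) := by
  rintro _ ⟨a, ha, rfl⟩ _ ⟨b, hb, rfl⟩
  obtain ⟨c, hc, hac, hbc⟩ := hs a ha b hb
  exact ⟨f c, ⟨c, hc, rfl⟩, hf hac, hf hbc⟩

/-- The category of compact regular frames and preframe homomorphisms. -/
instance KRFrmP.category : Category.{u} KRFrmP.{u} where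
  Hom := PreframeHom
  id L :=
    { toFun := fun a => a
      map_top := rfl
      map_inf := fun _ _ => rfl
      map_sSup := fun s _ _ => by rw [Set.image_id'] }
  comp {L M N} f g :=
    { toFun := fun a => g.toFun (f.toFun a)
      map_top := by rw [f.map_top, g.map_top]
      map_inf := fun a b => by rw [f.map_inf, g.map_inf]
      map_sSup := fun s hs hd => by
        rw [f.map_sSup s hs hd, g.map_sSup _ (hs.image _)
          (DirectedOn.image_mono hd f.monotone), Set.image_image] }

/-- A preframe homomorphism is a frame homomorphism if it preserves finite meets and arbitrary
joins. -/
def isFrameHom : MorphismProperty KRFrmP.{u} := fun L M f =>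
  ∃ g : FrameHom L.carrier M.carrier, ∀ a, g a = PreframeHom.toFun f a

instance isFrameHom_isMultiplicative : isFrameHom.{u}.IsMultiplicative where
  id_mem L := ⟨FrameHom.id _, fun _ => rfl⟩
  comp_mem {L M N} f g hf hg := by
    obtain ⟨f', hf⟩ := hf
    obtain ⟨g', hg⟩ := hg
    exact ⟨g'.comp f', fun a => by
      change g' (f' a) = PreframeHom.toFun g (PreframeHom.toFun f a); rw [hf, hg]⟩

/-- The category of compact regular frames and frame homomorphisms, as a wide subcategory of
the category of compact regular frames and preframe homomorphisms. -/
abbrev KRFrm : Type (u + 1) := WideSubcategory isFrameHom.{u}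

/-! ### Round ideals -/

/-- The round ideals of an S5-subordination algebra, ordered by inclusion. -/
def RoundIdeal (B : SubS5S.{u}) : Type u :=
  {I : Order.Ideal B.carrier // ∀ a ∈ I, ∃ b ∈ I, B.rel a b}

namespace RoundIdeal

variable {B B₁ B₂ B₃ : SubS5S.{u}}

instance : PartialOrder (RoundIdeal B) := Subtype.partialOrder _

instance : Membership B.carrier (RoundIdeal B) := ⟨fun I a => a ∈ I.1⟩

theorem le_def {I J : RoundIdeal B} : I ≤ J ↔ ∀ a ∈ I, a ∈ J := Iff.rfl

theorem ext {I J : RoundIdeal B} (h : ∀ a, a ∈ I ↔ a ∈ J) : I = J :=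
  le_antisymm (fun a => (h a).1) (fun a => (h a).2)

theorem mem_of_le {I : RoundIdeal B} {a b : B.carrier} (h : a ≤ b) (hb : b ∈ I) : a ∈ I :=
  I.1.lower h hb

theorem sup_mem {I : RoundIdeal B} {a b : B.carrier} (ha : a ∈ I) (hb : b ∈ I) : a ⊔ b ∈ I :=
  Order.Ideal.sup_mem ha hb

theorem bot_mem (I : RoundIdeal B) : ⊥ ∈ I := Order.Ideal.bot_mem I.1

theorem mem_of_rel {I : RoundIdeal B} {a b : B.carrier} (h : B.rel a b) (hb : b ∈ I) : a ∈ I :=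
  mem_of_le (B.le_of_rel h) hb

/-- An ideal given by closure properties. -/
def mkIdeal {A : Type u} [BooleanAlgebra A] (p : A → Prop) (bot : p ⊥)
    (sup : ∀ a b, p a → p b → p (a ⊔ b)) (mono : ∀ a b, a ≤ b → p b → p a) : Order.Ideal A where
  carrier := {a | p a}
  lower' := fun _ _ h hb => mono _ _ h hb
  nonempty' := ⟨⊥, bot⟩
  directed' := fun a ha b hb => ⟨a ⊔ b, sup a b ha hb, le_sup_left, le_sup_right⟩

/-- For a compatible subordination `T : B₁ → B₂` and an ideal `I` of `B₂`, the set `T⁻¹[I]`,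
which is a round ideal of `B₁`. -/
def preimage (T : CompatSub B₁ B₂) (I : Order.Ideal B₂.carrier) : RoundIdeal B₁ :=
  ⟨mkIdeal (fun a => ∃ b ∈ I, T.rel a b) ⟨⊥, I.bot_mem, T.isSubordination.bot_bot⟩
    (fun _ _ ⟨b, hb, h⟩ ⟨b', hb', h'⟩ => ⟨b ⊔ b', Order.Ideal.sup_mem hb hb',
      T.isSubordination.sup_left (T.isSubordination.mono le_rfl h le_sup_left)
        (T.isSubordination.mono le_rfl h' le_sup_right)⟩)
    (fun _ _ hle ⟨b, hb, h⟩ => ⟨b, hb, T.isSubordination.mono hle h le_rfl⟩),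
   fun _ ⟨b, hb, h⟩ =>
    have ⟨c, hc, hc'⟩ := T.left.1 h
    ⟨c, ⟨b, hb, hc'⟩, hc⟩⟩

theorem mem_preimage {T : CompatSub B₁ B₂} {I : Order.Ideal B₂.carrier} {a : B₁.carrier} :
    a ∈ preimage T I ↔ ∃ b ∈ I, T.rel a b := Iff.rfl

/-- The round ideal `S⁻¹[b]`. -/
def below (b : B.carrier) : RoundIdeal B := preimage (CompatSub.id B) (Order.Ideal.principal b)

theorem mem_below {a b : B.carrier} : a ∈ below b ↔ B.rel a b :=
  ⟨fun ⟨_, hc, h⟩ => B.isSubordination.mono le_rfl h hc, fun h => ⟨b, le_rfl, h⟩⟩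

instance : SupSet (RoundIdeal B) :=
  ⟨fun s => preimage (CompatSub.id B) (sSup (Subtype.val '' s))⟩

theorem isLUB_sSup (s : Set (RoundIdeal B)) : IsLUB s (sSup s) := by
  refine ⟨fun I hI a ha => ?_, fun J hJ a ⟨b, hb, h⟩ => ?_⟩
  · obtain ⟨b, hb, h⟩ := I.2 a ha
    have hI' : I.1 ∈ Subtype.val '' s := ⟨I, hI, rfl⟩
    exact ⟨b, le_sSup hI' hb, h⟩
  · have : sSup (Subtype.val '' s) ≤ J.1 := sSup_le (by rintro _ ⟨I, hI, rfl⟩; exact hJ hI)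
    exact mem_of_rel h (this hb)

/-- Membership in a join may be tested on ideals, round or not. -/
theorem sSup_sub {s : Set (RoundIdeal B)} (K : Order.Ideal B.carrier)
    (h : ∀ I ∈ s, ∀ a ∈ I, a ∈ K) {a : B.carrier} (ha : a ∈ sSup s) : a ∈ K := by
  obtain ⟨b, hb, hab⟩ := ha
  have : sSup (Subtype.val '' s) ≤ K := sSup_le (by rintro _ ⟨I, hI, rfl⟩; exact h I hI)
  exact K.lower (B.le_of_rel hab) (this hb)

instance : CompleteLattice (RoundIdeal B) :=
  { completeLatticeOfSup (RoundIdeal B) isLUB_sSup with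
    inf := fun I J => ⟨mkIdeal (fun a => a ∈ I ∧ a ∈ J) ⟨I.bot_mem, J.bot_mem⟩
      (fun _ _ h h' => ⟨sup_mem h.1 h'.1, sup_mem h.2 h'.2⟩)
      (fun _ _ hle h => ⟨mem_of_le hle h.1, mem_of_le hle h.2⟩),
      fun a ⟨h, h'⟩ =>
        have ⟨b, hb, hab⟩ := I.2 a h
        have ⟨c, hc, hac⟩ := J.2 a h'
        ⟨b ⊓ c, ⟨mem_of_le (I := I) inf_le_left hb, mem_of_le (I := J) inf_le_right hc⟩,
          B.isSubordination.inf_right hab hac⟩⟩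
    inf_le_left := fun _ _ _ h => h.1
    inf_le_right := fun _ _ _ h => h.2
    le_inf := fun _ _ _ h h' _ ha => ⟨h ha, h' ha⟩
    top := ⟨⊤, fun _ _ => ⟨⊤, trivial, B.isSubordination.mono le_top
      B.isSubordination.top_top le_rfl⟩⟩
    le_top := fun _ _ _ => trivial }

theorem mem_inf {I J : RoundIdeal B} {a : B.carrier} : a ∈ I ⊓ J ↔ a ∈ I ∧ a ∈ J := Iff.rfl

theorem mem_top (a : B.carrier) : a ∈ (⊤ : RoundIdeal B) := trivial

theorem mem_sSup_of_mem {s : Set (RoundIdeal B)} {I : RoundIdeal B} (hI : I ∈ s) {a : B.carrier}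
    (ha : a ∈ I) : a ∈ sSup s := (isLUB_sSup s).1 hI ha

/-- Directed joins of round ideals are unions. -/
theorem mem_sSup_of_directed {s : Set (RoundIdeal B)} (hs : s.Nonempty)
    (hd : DirectedOn (· ≤ ·) s) {a : B.carrier} : a ∈ sSup s ↔ ∃ I ∈ s, a ∈ I := by
  refine ⟨fun h => ?_, fun ⟨I, hI, ha⟩ => mem_sSup_of_mem hI ha⟩
  obtain ⟨I₀, hI₀⟩ := hs
  exact sSup_sub (mkIdeal (fun a => ∃ I ∈ s, a ∈ I) ⟨I₀, hI₀, I₀.bot_mem⟩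
    (fun a b ⟨I, hI, ha⟩ ⟨J, hJ, hb⟩ =>
      have ⟨K, hK, h₁, h₂⟩ := hd I hI J hJ
      ⟨K, hK, sup_mem (h₁ ha) (h₂ hb)⟩)
    (fun a b hle ⟨I, hI, hb⟩ => ⟨I, hI, mem_of_le hle hb⟩)) (fun I hI a ha => ⟨I, hI, ha⟩) h

theorem mem_bot {a : B.carrier} (h : a ∈ (⊥ : RoundIdeal B)) : a = ⊥ := by
  have h' : (⊥ : RoundIdeal B) ≤ below ⊥ := bot_le
  exact le_bot_iff.1 (B.le_of_rel (mem_below.1 (h' h)))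

theorem mem_sup {I J : RoundIdeal B} {a : B.carrier} :
    a ∈ I ⊔ J ↔ ∃ b ∈ I, ∃ c ∈ J, a ≤ b ⊔ c := by
  constructor
  · intro h
    have h' : a ∈ sSup {I, J} := by rwa [sSup_pair]
    have := sSup_sub (I.1 ⊔ J.1) (by
      rintro K (rfl | rfl) x hx
      · exact le_sup_left (a := K.1) (b := J.1) hx
      · exact le_sup_right (a := I.1) (b := K.1) hx) h'
    exact Order.Ideal.mem_sup.1 this
  · rintro ⟨b, hb, c, hc, h⟩
    exact mem_of_le h (sup_mem (le_sup_left (a := I) hb) (le_sup_right (b := J) hc))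

/-- Round ideals form a frame. -/
instance : Order.Frame (RoundIdeal B) :=
  Order.Frame.ofMinimalAxioms
    { inf_sSup_le_iSup_inf := fun I s a ⟨ha, has⟩ => by
        have := sSup_sub (mkIdeal (fun y => ∀ z ∈ I, z ⊓ y ∈ (⨆ J ∈ s, I ⊓ J : RoundIdeal B))
          (fun z _ => by rw [inf_bot_eq]; exact bot_mem _)
          (fun y y' h h' z hz => by rw [inf_sup_left]; exact sup_mem (h z hz) (h' z hz))
          (fun y y' hle h z hz => mem_of_le (inf_le_inf_left z hle) (h z hz)))
          (fun J hJ y hy z hz => le_iSup₂ (f := fun J (_ : J ∈ s) => I ⊓ J) J hJ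
            ⟨mem_of_le inf_le_left hz, mem_of_le inf_le_right hy⟩) has a ha
        rwa [inf_idem] at this }

/-- The well-inside relation on round ideals: `U(I)` meets `J`. -/
theorem wellInside_iff {I J : RoundIdeal B} :
    WellInside I J ↔ ∃ b ∈ J, ∀ a ∈ I, a ≤ b := by
  constructor
  · intro h
    have : (⊤ : B.carrier) ∈ Iᶜ ⊔ J := by rw [h]; trivial
    obtain ⟨c, hc, b, hb, hcb⟩ := mem_sup.1 this
    refine ⟨b, hb, fun a ha => ?_⟩
    have : a ⊓ c ∈ I ⊓ Iᶜ := ⟨mem_of_le inf_le_left ha, mem_of_le inf_le_right hc⟩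
    rw [inf_compl_self] at this
    have hac := mem_bot this
    calc a = a ⊓ (c ⊔ b) := by rw [top_le_iff.1 hcb, inf_top_eq]
      _ ≤ b := by rw [inf_sup_left, hac, bot_sup_eq]; exact inf_le_right
  · rintro ⟨b, hb, h⟩
    obtain ⟨c, hc, hbc⟩ := J.2 b hb
    have hle : below bᶜ ≤ Iᶜ := by
      rw [le_compl_iff_disjoint_left, disjoint_iff_inf_le]
      rintro a ⟨ha, ha'⟩
      have : a ≤ b ⊓ bᶜ := le_inf (h a ha) (B.le_of_rel (mem_below.1 ha'))
      rw [inf_compl_self, le_bot_iff] at this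
      rw [this]; exact bot_mem _
    rw [WellInside, eq_top_iff]
    intro a _
    refine mem_sup.2 ⟨cᶜ, hle (mem_below.2 (B.compl_rel_compl hbc)), c, hc, ?_⟩
    rw [compl_sup_eq_top]; exact le_top

theorem mem_compl {I : RoundIdeal B} {x : B.carrier} :
    x ∈ Iᶜ ↔ ∃ y, B.rel x y ∧ ∀ a ∈ I, a ≤ yᶜ := by
  constructor
  · intro h
    obtain ⟨y, hy, hxy⟩ := Iᶜ.2 x h
    refine ⟨y, hxy, fun a ha => ?_⟩
    have : a ⊓ y ∈ I ⊓ Iᶜ := ⟨mem_of_le inf_le_left ha, mem_of_le (I := Iᶜ) inf_le_right hy⟩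
    rw [inf_compl_self] at this
    exact le_compl_iff_disjoint_right.2 (disjoint_iff.2 (mem_bot this))
  · rintro ⟨y, hxy, h⟩
    have hle : below y ≤ Iᶜ := by
      rw [le_compl_iff_disjoint_left, disjoint_iff_inf_le]
      rintro a ⟨ha, ha'⟩
      have : a ≤ y ⊓ yᶜ := le_inf (B.le_of_rel (mem_below.1 ha')) (h a ha)
      rw [inf_compl_self, le_bot_iff] at this
      rw [this]; exact bot_mem _
    exact hle (mem_below.2 hxy)

theorem wellInside_below {b : B.carrier} {J : RoundIdeal B} (hb : b ∈ J) :
    WellInside (below b) J :=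
  wellInside_iff.2 ⟨b, hb, fun _ ha => B.le_of_rel (mem_below.1 ha)⟩

theorem isCompactElement_top : IsCompactElement (⊤ : RoundIdeal B) := by
  rw [CompleteLattice.isCompactElement_iff_le_of_directed_sSup_le]
  intro s hs hd h
  obtain ⟨I, hI, h1⟩ := (mem_sSup_of_directed hs hd).1 (h (mem_top ⊤))
  exact ⟨I, hI, fun a _ => mem_of_le le_top h1⟩

theorem eq_sSup_wellInside (I : RoundIdeal B) : I = sSup {J | WellInside J I} := by
  refine le_antisymm (fun a ha => ?_) (sSup_le fun J hJ a ha => ?_)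
  · obtain ⟨b, hb, hab⟩ := I.2 a ha
    have hmem : below b ∈ {J | WellInside J I} := wellInside_below hb
    exact mem_sSup_of_mem hmem (mem_below.2 hab)
  · have hJ' : WellInside J I := hJ
    obtain ⟨b, hb, h⟩ := wellInside_iff.1 hJ'
    exact mem_of_le (h a ha) hb

end RoundIdeal

/-- The compact regular frame of round ideals. -/
def roundIdealFrame (B : SubS5S.{u}) : KRFrmP.{u} where
  carrier := RoundIdeal B
  isCompact := RoundIdeal.isCompactElement_top
  isRegular := RoundIdeal.eq_sSup_wellInside

/-- The preframe homomorphism `I ↦ T⁻¹[I]`. -/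
def roundIdealMap {B₁ B₂ : SubS5S.{u}} (T : CompatSub B₁ B₂) :
    PreframeHom (roundIdealFrame B₂) (roundIdealFrame B₁) where
  toFun := fun I : RoundIdeal B₂ => (RoundIdeal.preimage T I.1 : RoundIdeal B₁)
  map_top := by
    refine RoundIdeal.ext fun a => ⟨fun _ => trivial, fun _ => ⟨⊤, trivial, ?_⟩⟩
    exact T.isSubordination.mono le_top T.isSubordination.top_top le_rfl
  map_inf := fun I J => RoundIdeal.ext fun a =>
    ⟨fun ⟨b, hb, h⟩ => ⟨⟨b, hb.1, h⟩, ⟨b, hb.2, h⟩⟩, fun ⟨⟨b, hb, h⟩, ⟨c, hc, h'⟩⟩ =>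
      ⟨b ⊓ c, ⟨RoundIdeal.mem_of_le (I := I) inf_le_left hb,
        RoundIdeal.mem_of_le (I := J) inf_le_right hc⟩, T.isSubordination.inf_right h h'⟩⟩
  map_sSup := fun (s : Set (RoundIdeal B₂)) hs hd => by
    have hm : Monotone fun I : RoundIdeal B₂ => RoundIdeal.preimage T I.1 :=
      fun I J h a ⟨b, hb, hab⟩ => ⟨b, h hb, hab⟩
    refine RoundIdeal.ext fun a => Iff.trans ?_ (RoundIdeal.mem_sSup_of_directed (hs.image _)
      (DirectedOn.image_mono hd hm)).symm
    constructor
    · rintro ⟨b, hb, h⟩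
      obtain ⟨I, hI, hbI⟩ := (RoundIdeal.mem_sSup_of_directed hs hd).1 hb
      exact ⟨_, ⟨I, hI, rfl⟩, ⟨b, hbI, h⟩⟩
    · rintro ⟨_, ⟨I, hI, rfl⟩, ⟨b, hb, h⟩⟩
      exact ⟨b, RoundIdeal.mem_sSup_of_mem hI hb, h⟩

/-- The contravariant functor of round ideals, sending a morphism `T` to `I ↦ T⁻¹[I]`. -/
def RI : SubS5S.{u} ⥤ KRFrmP.{u}ᵒᵖ where
  obj B := Opposite.op (roundIdealFrame B)
  map T := Quiver.Hom.op (X := roundIdealFrame _) (Y := roundIdealFrame _) (roundIdealMap T)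
  map_id B := by
    apply Quiver.Hom.unop_inj
    refine PreframeHom.ext (funext fun I : RoundIdeal B => RoundIdeal.ext fun a => ?_)
    exact ⟨fun ⟨b, hb, h⟩ => RoundIdeal.mem_of_rel (I := I) h hb,
      fun ha => have ⟨b, hb, h⟩ := I.2 a ha; ⟨b, hb, h⟩⟩
  map_comp {B₁ B₂ B₃} T U := by
    apply Quiver.Hom.unop_inj
    refine PreframeHom.ext (funext fun I : RoundIdeal B₃ => RoundIdeal.ext fun a => ?_)
    exact ⟨fun ⟨c, hc, ⟨b, h, h'⟩⟩ => ⟨b, ⟨c, hc, h'⟩, h⟩,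
      fun ⟨b, ⟨c, hc, h'⟩, h⟩ => ⟨c, hc, ⟨b, h, h'⟩⟩⟩

/-! ### Booleanizations of compact regular frames -/

namespace WellInside

variable {L : Type u} [Order.Frame L] {a b c d : L}

theorem le (h : WellInside a b) : a ≤ b := by
  have : a = a ⊓ (aᶜ ⊔ b) := by rw [show aᶜ ⊔ b = ⊤ from h, inf_top_eq]
  rw [this, inf_sup_left, inf_compl_self, bot_sup_eq]
  exact inf_le_right

theorem mono (h : a ≤ b) (h' : WellInside b c) (h'' : c ≤ d) : WellInside a d :=
  top_le_iff.1 ((show bᶜ ⊔ c = ⊤ from h').ge.trans (sup_le_sup (compl_le_compl h) h''))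

theorem inf (h : WellInside a c) (h' : WellInside a d) : WellInside a (c ⊓ d) := by
  rw [WellInside, sup_inf_left, show aᶜ ⊔ c = ⊤ from h, show aᶜ ⊔ d = ⊤ from h', inf_top_eq]

theorem sup (h : WellInside a c) (h' : WellInside b c) : WellInside (a ⊔ b) c := by
  rw [WellInside, compl_sup, sup_inf_right, show aᶜ ⊔ c = ⊤ from h, show bᶜ ⊔ c = ⊤ from h',
    inf_top_eq]

theorem compl_compl (h : WellInside a b) : WellInside aᶜᶜ b := by
  rwa [WellInside, compl_compl_compl]

theorem compl (h : WellInside a b) : WellInside bᶜ aᶜ := by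
  rw [WellInside, sup_comm]
  exact top_le_iff.1 ((show aᶜ ⊔ b = ⊤ from h).ge.trans (sup_le_sup le_rfl le_compl_compl))

theorem bot : WellInside ⊥ a := by rw [WellInside, compl_bot, top_sup_eq]

theorem top : WellInside a ⊤ := sup_top_eq _

end WellInside

namespace KRFrmP

variable {L M : KRFrmP.{u}}

theorem exists_wellInside_of_directed {b : L.carrier} {D : Set L.carrier} (hne : D.Nonempty)
    (hd : DirectedOn (· ≤ ·) D) (h : WellInside b (sSup D)) : ∃ d ∈ D, WellInside b d := by
  have hm : Monotone fun d : L.carrier => bᶜ ⊔ d := fun _ _ h => sup_le_sup le_rfl h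
  have hle : (⊤ : L.carrier) ≤ sSup ((fun d => bᶜ ⊔ d) '' D) := by
    rw [← show bᶜ ⊔ sSup D = ⊤ from h]
    obtain ⟨d, hd⟩ := hne
    refine sup_le (le_sup_left.trans (le_sSup ⟨d, hd, rfl⟩)) (sSup_le fun d hd => ?_)
    exact le_sup_right.trans (le_sSup (Set.mem_image_of_mem (fun d => bᶜ ⊔ d) hd))
  obtain ⟨_, ⟨d, hd, rfl⟩, h⟩ :=
    (CompleteLattice.isCompactElement_iff_le_of_directed_sSup_le _ _).1 L.isCompact _
      (hne.image _) (DirectedOn.image_mono hd hm) hle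
  exact ⟨d, hd, top_le_iff.1 h⟩

/-- The regular elements well inside `a`. -/
def regularBelow (a : L.carrier) : Set L.carrier := {x | xᶜᶜ = x ∧ WellInside x a}

theorem regularBelow_nonempty (a : L.carrier) : (regularBelow a).Nonempty :=
  ⟨⊥, by rw [compl_bot, compl_top], WellInside.bot⟩

theorem regularBelow_directed (a : L.carrier) : DirectedOn (· ≤ ·) (regularBelow a) := by
  rintro x ⟨_, hx⟩ y ⟨_, hy⟩
  exact ⟨(x ⊔ y)ᶜᶜ, ⟨compl_compl_compl _, (hx.sup hy).compl_compl⟩,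
    le_sup_left.trans le_compl_compl, le_sup_right.trans le_compl_compl⟩

theorem sSup_regularBelow (a : L.carrier) : sSup (regularBelow a) = a := by
  refine le_antisymm (sSup_le fun x hx => hx.2.le) ?_
  conv_lhs => rw [L.isRegular a]
  refine sSup_le fun x (hx : WellInside x a) => le_compl_compl.trans (le_sSup ?_)
  exact ⟨compl_compl_compl _, hx.compl_compl⟩

/-- If `b ≺ □ a` then `b ≺ □ c` for some regular `c ≺ a`. -/
theorem exists_between_map (f : PreframeHom L M) {b : M.carrier} {a : L.carrier}
    (h : WellInside b (f.toFun a)) :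
    ∃ c : Heyting.Regular L.carrier, WellInside b (f.toFun c) ∧ WellInside (c : L.carrier) a := by
  rw [← sSup_regularBelow a, f.map_sSup _ (regularBelow_nonempty a) (regularBelow_directed a)] at h
  obtain ⟨_, ⟨c, hc, rfl⟩, h'⟩ := exists_wellInside_of_directed
    ((regularBelow_nonempty a).image _)
    (DirectedOn.image_mono (regularBelow_directed a) f.monotone) h
  exact ⟨⟨c, hc.1⟩, h', hc.2⟩

theorem exists_between {a b : L.carrier} (h : WellInside b a) :
    ∃ c : Heyting.Regular L.carrier, WellInside b (c : L.carrier) ∧ WellInside (c : L.carrier) a :=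
  exists_between_map (𝟙 L : PreframeHom L L) h

theorem relSubordination (f : PreframeHom L M) :
    IsSubordination fun (b : Heyting.Regular M.carrier) (a : Heyting.Regular L.carrier) =>
      WellInside (b : M.carrier) (f.toFun a) where
  bot_bot := WellInside.bot
  top_top := by
    change WellInside _ (f.toFun ⊤)
    rw [f.map_top]; exact WellInside.top
  sup_left h h' := (h.sup h').compl_compl
  inf_right {b a a'} h h' := by
    change WellInside _ (f.toFun ((a : L.carrier) ⊓ a'))
    rw [f.map_inf]; exact h.inf h'
  mono h h' h'' := WellInside.mono h h' (f.monotone h'')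

/-- The booleanization of a compact regular frame, with the restriction of the well-inside
relation. Its elements are the `a` with `a = a**`. -/
def regularAlgebra (L : KRFrmP.{u}) : SubS5S.{u} where
  carrier := Heyting.Regular L.carrier
  rel a b := WellInside (a : L.carrier) (b : L.carrier)
  isSubordination := relSubordination (𝟙 L : PreframeHom L L)
  le_of_rel h := h.le
  compl_rel_compl h := h.compl
  exists_between h := exists_between h

theorem isDeVries_regularAlgebra (L : KRFrmP.{u}) : isDeVries (regularAlgebra L) := by
  constructor
  · intro (a : Heyting.Regular L.carrier) ha
    by_contra hcon
    apply ha
    apply Heyting.Regular.coe_injective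
    change (a : L.carrier) = ⊥
    rw [← sSup_regularBelow (a : L.carrier), ← le_bot_iff]
    refine sSup_le fun x hx => ?_
    by_contra hx0
    refine hcon ⟨(⟨x, hx.1⟩ : Heyting.Regular L.carrier), fun h => hx0 ?_, hx.2⟩
    exact (congrArg Heyting.Regular.val h).le
  · intro (s : Set (Heyting.Regular L.carrier))
    refine ⟨Heyting.Regular.toRegular (sSup (Heyting.Regular.val '' s)), fun a ha => ?_, fun b hb => ?_⟩
    · have : a.val ≤ sSup (Heyting.Regular.val '' s) := le_sSup ⟨a, ha, rfl⟩
      exact this.trans le_compl_compl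
    · refine Heyting.Regular.gi.gc.l_le (sSup_le ?_)
      rintro _ ⟨a, ha, rfl⟩
      exact hb ha

/-- The relation `b ≺ □ a` as a compatible subordination. -/
def regularMap (f : PreframeHom L M) : CompatSub (regularAlgebra M) (regularAlgebra L) where
  rel := fun (b : Heyting.Regular M.carrier) (a : Heyting.Regular L.carrier) =>
    WellInside (b : M.carrier) (f.toFun a)
  isSubordination := relSubordination f
  comp_right := by
    ext b a
    exact ⟨fun ⟨_, h, h'⟩ => h.mono le_rfl (f.monotone h'.le), fun h => exists_between_map f h⟩
  comp_left := by
    ext b a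
    exact ⟨fun ⟨_, h, h'⟩ => WellInside.mono h.le h' le_rfl, fun h => exists_between h⟩

end KRFrmP

/-- The contravariant booleanization functor, sending a morphism `□` to the relation
`b ≺ □ a`. -/
def booleanization : KRFrmP.{u}ᵒᵖ ⥤ DeVS.{u} where
  obj L := ⟨L.unop.regularAlgebra, L.unop.isDeVries_regularAlgebra⟩
  map f := ObjectProperty.homMk (KRFrmP.regularMap f.unop)
  map_id _ := rfl
  map_comp {L M N} f g := by
    apply ObjectProperty.hom_ext
    apply CompatSub.ext
    ext c a
    exact ⟨fun h => KRFrmP.exists_between_map (b := c.val) f.unop h,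
      fun ⟨_, h, h'⟩ => WellInside.mono le_rfl h (f.unop.monotone h'.le)⟩

/-! ### The dual equivalences -/

/-- The morphism `T̂ : B₂ → B₁` associated with `T : B₁ → B₂`. -/
def CompatSub.converse {B₁ B₂ : SubS5S.{u}} (T : CompatSub B₁ B₂) : CompatSub B₂ B₁ where
  rel := hat T.rel
  isSubordination :=
    { bot_bot := by simpa [hat] using T.isSubordination.top_top
      top_top := by simpa [hat] using T.isSubordination.bot_bot
      sup_left := fun h h' => by
        simpa [hat, compl_sup] using T.isSubordination.inf_right h h'
      inf_right := fun h h' => by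
        simpa [hat, compl_inf] using T.isSubordination.sup_left h h'
      mono := fun h h' h'' =>
        T.isSubordination.mono (compl_le_compl h'') h' (compl_le_compl h) }
  comp_right := by
    ext b a
    constructor
    · rintro ⟨c, h, h'⟩
      exact T.left.2 ⟨cᶜ, B₁.compl_rel_compl h', h⟩
    · intro h
      obtain ⟨c, hc, hc'⟩ := T.left.1 h
      refine ⟨cᶜ, by simpa [hat] using hc', ?_⟩
      simpa using B₁.compl_rel_compl hc
  comp_left := by
    ext b a
    constructor
    · rintro ⟨c, h, h'⟩
      exact T.right.2 ⟨cᶜ, h', B₂.compl_rel_compl h⟩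
    · intro h
      obtain ⟨c, hc, hc'⟩ := T.right.1 h
      refine ⟨cᶜ, ?_, by simpa [hat] using hc⟩
      simpa using B₂.compl_rel_compl hc'

namespace RoundIdeal

variable {B : SubS5S.{u}}

/-- Any element of a round ideal `J` lies in a normal round ideal well inside `J`. -/
theorem exists_normal {J : RoundIdeal B} {a : B.carrier} (ha : a ∈ J) :
    ∃ I : Heyting.Regular (RoundIdeal B), a ∈ I.val ∧ WellInside I.val J := by
  obtain ⟨b, hb, hab⟩ := J.2 a ha
  refine ⟨⟨(below b)ᶜᶜ, compl_compl_compl _⟩, ?_, (wellInside_below hb).compl_compl⟩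
  exact (le_compl_compl : below b ≤ _) (mem_below.2 hab)

/-- The relation `Q` given by `a Q I` iff `a ∈ I`. -/
def unitHom (B : SubS5S.{u}) : CompatSub B (roundIdealFrame B).regularAlgebra where
  rel := fun a (I : Heyting.Regular (RoundIdeal B)) => a ∈ I.val
  isSubordination :=
    { bot_bot := bot_mem (B := B) _
      top_top := mem_top (B := B) _
      sup_left := fun {a b} I h h' => sup_mem (B := B) h h'
      inf_right := fun h h' => ⟨h, h'⟩
      mono := fun h h' h'' => h'' (mem_of_le (B := B) h h') }
  comp_right := by
    ext a J
    exact ⟨fun ⟨_, h, h'⟩ => h'.le h, fun h => exists_normal (B := B) h⟩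
  comp_left := by
    ext a J
    exact ⟨fun ⟨_, h, h'⟩ => mem_of_rel (B := B) h h', fun h =>
      have ⟨b, hb, hab⟩ := (show Heyting.Regular (RoundIdeal B) from J).val.2 a h
      ⟨b, hab, hb⟩⟩

theorem unitHom_converse (B : SubS5S.{u}) : (unitHom B).comp (unitHom B).converse =
    CompatSub.id B := by
  apply CompatSub.ext
  ext a b
  constructor
  · rintro ⟨(I : Heyting.Regular (RoundIdeal B)), ha, hb⟩
    have hb' : bᶜ ∈ I.valᶜ := hb
    obtain ⟨c, hc, hI⟩ := mem_compl.1 hb'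
    have := B.compl_rel_compl hc
    rw [compl_compl] at this
    exact B.isSubordination.mono (hI a ha) this le_rfl
  · intro h
    obtain ⟨c, hac, hcb⟩ := B.exists_between h
    refine ⟨(⟨(below c)ᶜᶜ, compl_compl_compl _⟩ : Heyting.Regular (RoundIdeal B)),
      (le_compl_compl : below c ≤ _) (mem_below.2 hac), ?_⟩
    have : bᶜ ∈ (below c)ᶜ := mem_compl.2 ⟨cᶜ, B.compl_rel_compl hcb, fun x hx => by
      rw [compl_compl]; exact B.le_of_rel (mem_below.1 hx)⟩
    exact (le_compl_compl : (below c)ᶜ ≤ _) this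

theorem converse_unitHom (B : SubS5S.{u}) : (unitHom B).converse.comp (unitHom B) =
    CompatSub.id _ := by
  apply CompatSub.ext
  ext (I : Heyting.Regular (RoundIdeal B)) (J : Heyting.Regular (RoundIdeal B))
  refine Iff.trans ?_ (wellInside_iff (I := I.val) (J := J.val)).symm
  constructor
  · rintro ⟨a, ha, haJ⟩
    have ha' : aᶜ ∈ I.valᶜ := ha
    obtain ⟨c, hc, hI⟩ := mem_compl.1 ha'
    refine ⟨a, haJ, fun x hx => (hI x hx).trans ?_⟩
    rw [← compl_compl a]
    exact compl_le_compl (B.le_of_rel hc)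
  · rintro ⟨b, hb, hI⟩
    obtain ⟨a, ha, hba⟩ := J.val.2 b hb
    refine ⟨a, ?_, ha⟩
    exact mem_compl.2 ⟨bᶜ, B.compl_rel_compl hba, fun x hx => by rw [compl_compl]; exact hI x hx⟩

end RoundIdeal

/-- The natural isomorphism `Q`, with `a Q I` iff `a ∈ I`. -/
def unitIso : 𝟭 SubS5S.{u} ≅ RI ⋙ booleanization ⋙ isDeVries.ι :=
  NatIso.ofComponents
    (fun B =>
      { hom := RoundIdeal.unitHom B
        inv := (RoundIdeal.unitHom B).converse
        hom_inv_id := RoundIdeal.unitHom_converse B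
        inv_hom_id := RoundIdeal.converse_unitHom B })
    (fun {B₁ B₂} T => by
      apply CompatSub.ext
      ext a (I : Heyting.Regular (RoundIdeal B₂))
      constructor
      · rintro ⟨b, h, h'⟩
        exact RoundIdeal.exists_normal (J := RoundIdeal.preimage T I.val.1) ⟨b, h', h⟩
      · rintro ⟨J, h, h'⟩
        obtain ⟨b, hb, hab⟩ := WellInside.le h' h
        exact ⟨b, hab, hb⟩)

namespace KRFrmP

/-- An order isomorphism is a preframe isomorphism. -/
def isoOfOrderIso {L M : KRFrmP.{u}} (e : L.carrier ≃o M.carrier) : L ≅ M where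
  hom :=
    { toFun := e
      map_top := e.map_top
      map_inf := e.map_inf
      map_sSup := fun s _ _ => by rw [e.map_sSup, sSup_image] }
  inv :=
    { toFun := e.symm
      map_top := e.symm.map_top
      map_inf := e.symm.map_inf
      map_sSup := fun s _ _ => by rw [e.symm.map_sSup, sSup_image] }
  hom_inv_id := PreframeHom.ext (funext e.symm_apply_apply)
  inv_hom_id := PreframeHom.ext (funext e.apply_symm_apply)

/-- The round ideal of all regular elements well inside `a`. -/
def wellBelow (L : KRFrmP.{u}) (a : L.carrier) : RoundIdeal L.regularAlgebra :=
  ⟨RoundIdeal.mkIdeal (fun b : Heyting.Regular L.carrier => WellInside b.val a) WellInside.bot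
    (fun _ _ h h' => (h.sup h').compl_compl) (fun _ _ h h' => WellInside.mono h h' le_rfl),
    fun _ h => have ⟨c, hc, hc'⟩ := exists_between h; ⟨c, hc', hc⟩⟩

/-- The frame isomorphism `a ↦ {b ∈ 𝔅L | b ≺ a}` from `L` to the round ideals of `𝔅L`. -/
def wellBelowIso (L : KRFrmP.{u}) : L.carrier ≃o RoundIdeal L.regularAlgebra where
  toFun := L.wellBelow
  invFun I := sSup {x | ∃ b : Heyting.Regular L.carrier, b ∈ I.1 ∧ b.val = x}
  left_inv a := by
    refine Eq.trans (congrArg sSup (Set.ext fun x => ?_)) (sSup_regularBelow a)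
    exact ⟨fun ⟨b, hb, hx⟩ => hx ▸ ⟨b.2, hb⟩, fun hx => ⟨⟨x, hx.1⟩, hx.2, rfl⟩⟩
  right_inv I := by
    refine RoundIdeal.ext fun (b : Heyting.Regular L.carrier) => ⟨fun h => ?_, fun h => ?_⟩
    · have hne : {x | ∃ b : Heyting.Regular L.carrier, b ∈ I.1 ∧ b.val = x}.Nonempty :=
        ⟨_, ⟨⊥, RoundIdeal.bot_mem I, rfl⟩⟩
      obtain ⟨_, ⟨c, hc, rfl⟩, hbc⟩ := exists_wellInside_of_directed hne (by
          rintro _ ⟨c, hc, rfl⟩ _ ⟨d, hd, rfl⟩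
          exact ⟨_, ⟨c ⊔ d, RoundIdeal.sup_mem (I := I) hc hd, rfl⟩,
            (le_sup_left : c ≤ c ⊔ d), (le_sup_right : d ≤ c ⊔ d)⟩) h
      exact RoundIdeal.mem_of_rel (I := I) hbc hc
    · obtain ⟨c, hc, hbc⟩ := I.2 b h
      exact WellInside.mono le_rfl hbc (le_sSup ⟨c, hc, rfl⟩)
  map_rel_iff' {a a'} := by
    constructor
    · intro h
      rw [← sSup_regularBelow a]
      refine sSup_le fun x hx => ?_
      have : (⟨x, hx.1⟩ : Heyting.Regular L.carrier) ∈ L.wellBelow a' := h hx.2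
      exact WellInside.le this
    · exact fun h b hb => WellInside.mono le_rfl hb h

end KRFrmP

/-- The natural isomorphism `f`, with `f a = {b ∈ 𝔅L | b ≺ a}`. -/
def counitIso : (booleanization.{u} ⋙ isDeVries.ι) ⋙ RI ≅ 𝟭 KRFrmP.{u}ᵒᵖ :=
  NatIso.ofComponents (fun L => (KRFrmP.isoOfOrderIso L.unop.wellBelowIso).op)
    (fun {L M} f => by
      apply Quiver.Hom.unop_inj
      refine PreframeHom.ext (funext fun a : M.unop.carrier => RoundIdeal.ext
        fun b : Heyting.Regular L.unop.carrier => ?_)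
      change b ∈ RoundIdeal.preimage (KRFrmP.regularMap f.unop) (M.unop.wellBelow a).1 ↔
        WellInside b.val (f.unop.toFun a)
      constructor
      · rintro ⟨c, hc, hc'⟩
        exact WellInside.mono le_rfl hc' (f.unop.monotone (WellInside.le hc))
      · intro h
        obtain ⟨c, hc, hc'⟩ := KRFrmP.exists_between_map f.unop h
        exact ⟨c, hc', hc⟩)

/-- The dual equivalence between `SubS5S` and `KRFrmP` formed by the round ideal functor and the
booleanization functor. -/
def dualEquivalenceSubS5S : SubS5S.{u} ≌ KRFrmP.{u}ᵒᵖ where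
  functor := RI
  inverse := booleanization ⋙ isDeVries.ι
  unitIso := unitIso
  counitIso := counitIso
  functor_unitIso_comp B := by
    apply Quiver.Hom.unop_inj
    refine PreframeHom.ext (funext fun I : RoundIdeal B => RoundIdeal.ext fun a => ?_)
    change a ∈ RoundIdeal.preimage (RoundIdeal.unitHom B) ((roundIdealFrame B).wellBelow I).1 ↔ a ∈ I
    constructor
    · rintro ⟨J, hJ, ha⟩
      exact WellInside.le hJ ha
    · intro h
      obtain ⟨J, ha, hJ⟩ := RoundIdeal.exists_normal (J := I) h
      exact ⟨J, hJ, ha⟩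

/-- The dual equivalence between `DeVS` and `KRFrmP` formed by (the restriction of) the round ideal
functor and the booleanization functor. -/
def dualEquivalenceDeVS : DeVS.{u} ≌ KRFrmP.{u}ᵒᵖ where
  functor := isDeVries.ι ⋙ RI
  inverse := booleanization
  unitIso := NatIso.ofComponents (fun B => isDeVries.isoMk (unitIso.app B.obj))
    (fun T => ObjectProperty.hom_ext _ (unitIso.hom.naturality T.hom))
  counitIso := counitIso
  functor_unitIso_comp B := dualEquivalenceSubS5S.functor_unitIso_comp B.obj

/-! ### Restriction to wide subcategories -/

/-- A dual equivalence `e` between `C` and `D` restricts to a dual equivalence `e'` between the wide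
subcategories of `C` and `D` given by `P` and `Q`: both contravariant functors of `e'` and both
natural isomorphisms of `e'` are restrictions of those of `e`. -/
structure RestrictsTo {C D : Type (u + 1)} [Category.{u} C] [Category.{u} D] (e : C ≌ Dᵒᵖ)
    (P : MorphismProperty C) (Q : MorphismProperty D) [P.IsMultiplicative] [Q.IsMultiplicative]
    (e' : WideSubcategory P ≌ (WideSubcategory Q)ᵒᵖ) : Prop where
  functor_eq : e'.functor ⋙ (wideSubcategoryInclusion Q).op =
    wideSubcategoryInclusion P ⋙ e.functor
  inverse_eq : e'.inverse ⋙ wideSubcategoryInclusion P =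
    (wideSubcategoryInclusion Q).op ⋙ e.inverse
  unit_heq : ∀ X : WideSubcategory P, HEq (e'.unit.app X).hom (e.unit.app X.obj)
  counit_heq : ∀ Y : (WideSubcategory Q)ᵒᵖ,
    HEq (e'.counit.app Y).unop.hom (e.counit.app (Opposite.op Y.unop.obj)).unop

/-! ### Functional morphisms induce frame homomorphisms -/

/-! An equivalence restricts to wide subcategories once both functors carry the chosen morphisms to
chosen morphisms and the components of unit and counit, together with their inverses, are chosen;
naturality and the triangle identity are then inherited (`exists_restrictsTo`). Three facts remain.

If `T` is functional, `I ↦ T⁻¹[I]` preserves finite joins (`isFrameHom_roundIdealMap`), and a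
preframe homomorphism preserving finite joins preserves all joins, since an arbitrary join is a
directed join of finite ones. The condition `S₂ ⊆ T ∘ T̂` lifts the parts of a cover `b ≤ c ∨ d` in
`B₂` to elements of `B₁`; the condition `T̂ ∘ T ⊆ S₁` then turns `a T b` into a cover of `a` by
those elements.

If `g` is a frame homomorphism, the relation `b ≺ g a` is functional (`functional_regularMap`):
preservation of disjointness, `g a ∧ g a* = 0`, gives the first condition, and preservation of the
cover `a* ∨ c = 1` gives the second.

The inverse of `Q` is its own `T̂`, and the two inverse laws contain the two conditions for being
functional. The counit component is an order isomorphism, so it and its inverse preserve all joins.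
-/

/-- Splits an arbitrary join into finite joins and one outer join, which is directed because the
union of two finite subsets of `s` is again one. -/
theorem sSup_eq_sSup_finset_sup {L : Type u} [CompleteLattice L] (s : Set L) :
    sSup s = sSup {x | ∃ t : Finset L, ↑t ⊆ s ∧ t.sup (fun y => y) = x} := by
  refine le_antisymm (sSup_le fun x hx => le_sSup ⟨{x}, by simpa using hx, by simp⟩) (sSup_le ?_)
  rintro _ ⟨t, ht, rfl⟩
  exact Finset.sup_le fun y hy => le_sSup (ht hy)

/-- A preframe homomorphism that preserves finite joins is a frame homomorphism. -/
theorem isFrameHom_of_map_sup {L M : KRFrmP.{u}} (f : L ⟶ M)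
    (map_bot : PreframeHom.toFun f ⊥ = ⊥)
    (map_sup : ∀ a b, PreframeHom.toFun f (a ⊔ b) = PreframeHom.toFun f a ⊔ PreframeHom.toFun f b) :
    isFrameHom f := by
  classical
  have map_finset (t : Finset L.carrier) :
      PreframeHom.toFun f (t.sup fun y => y) = t.sup (PreframeHom.toFun f) := by
    induction t using Finset.induction_on with
    | empty => simpa using map_bot
    | insert a t _ ih => rw [Finset.sup_insert, Finset.sup_insert, map_sup, ih]
  refine ⟨{ toFun := PreframeHom.toFun f
            map_inf' := PreframeHom.map_inf f
            map_top' := PreframeHom.map_top f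
            map_sSup' := fun s => le_antisymm ?_ (sSup_le ?_) }, fun _ => rfl⟩
  -- The inequality `f (⋁ s) ≤ ⋁ f[s]` is the only nontrivial one: `f` commutes with the outer
  -- directed join by hypothesis and with each finite join by `map_finset`. The empty subset makes
  -- the directed family nonempty.
  · rw [sSup_eq_sSup_finset_sup s, PreframeHom.map_sSup f]
    · refine sSup_le ?_
      rintro _ ⟨_, ⟨t, ht, rfl⟩, rfl⟩
      rw [map_finset]
      exact Finset.sup_le fun y hy => le_sSup ⟨y, ht hy, rfl⟩
    · exact ⟨⊥, ∅, by simp, rfl⟩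
    · rintro _ ⟨t, ht, rfl⟩ _ ⟨t', ht', rfl⟩
      exact ⟨_, ⟨t ∪ t', by simp [ht, ht'], rfl⟩, Finset.sup_mono Finset.subset_union_left,
        Finset.sup_mono Finset.subset_union_right⟩
  · rintro _ ⟨a, ha, rfl⟩
    exact PreframeHom.monotone f (le_sSup ha)

/-- Only `⊥` and binary joins need an argument. Both use `T̂ ∘ T ⊆ S₁` in the form: if `a T b` and
`b T̂ a'`, then `a ≤ a'`. -/
theorem isFrameHom_roundIdealMap {B₁ B₂ : SubS5S.{u}} {T : B₁ ⟶ B₂} (hT : functional T) :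
    isFrameHom (X := roundIdealFrame B₂) (Y := roundIdealFrame B₁) (roundIdealMap T) := by
  refine isFrameHom_of_map_sup (L := roundIdealFrame B₂) (M := roundIdealFrame B₁)
    (roundIdealMap T) ?_ fun (I J : RoundIdeal B₂) => ?_
  · refine RoundIdeal.ext fun a => ⟨?_, fun h => ?_⟩
    · rintro ⟨b, hb, hab⟩
      obtain rfl : b = ⊥ := RoundIdeal.mem_bot hb
      -- `⊥ T̂ ⊥` unfolds to `⊤ T ⊤`, so `a T ⊥` yields `a S₁ ⊥`.
      have ha : B₁.rel a ⊥ := hT.1 a ⊥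
        ⟨⊥, hab, by simpa [hat] using (CompatSub.isSubordination T).top_top⟩
      rw [le_bot_iff.1 (B₁.le_of_rel ha)]
      exact RoundIdeal.bot_mem (B := B₁) _
    · obtain rfl : a = ⊥ := RoundIdeal.mem_bot h
      exact RoundIdeal.bot_mem (B := B₁) _
  · refine le_antisymm ?_ (sup_le (PreframeHom.monotone (roundIdealMap T) le_sup_left)
      (PreframeHom.monotone (roundIdealMap T) le_sup_right))
    rintro a ⟨b, hb, hab⟩
    obtain ⟨c, hc, d, hd, hbcd⟩ := RoundIdeal.mem_sup.1 hb
    -- Roundness gives `c S₂ c'` and `d S₂ d'` inside `I` and `J`, which is what `S₂ ⊆ T ∘ T̂` needs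
    -- in order to produce `c T̂ x T c'` and `d T̂ y T d'`.
    obtain ⟨c', hc', hcc'⟩ := I.2 c hc
    obtain ⟨d', hd', hdd'⟩ := J.2 d hd
    obtain ⟨x, hcx, hxc'⟩ := hT.2 c c' hcc'
    obtain ⟨y, hdy, hyd'⟩ := hT.2 d d' hdd'
    -- `x` and `y` lie in the two preimages, so it suffices that `a ≤ x ∨ y`. As `a T b`, this
    -- reduces to `b T̂ (x ∨ y)`, which holds because `b ≤ c ∨ d` with `c T̂ x` and `d T̂ y`.
    refine RoundIdeal.mem_sup.2 ⟨x, ⟨c', hc', hxc'⟩, y, ⟨d', hd', hyd'⟩,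
      B₁.le_of_rel (hT.1 a (x ⊔ y) ⟨b, hab, ?_⟩)⟩
    have hS := CompatSub.isSubordination T
    change CompatSub.rel T (x ⊔ y)ᶜ bᶜ
    refine hS.mono le_rfl (hS.inf_right (hS.mono ?_ hcx le_rfl) (hS.mono ?_ hdy le_rfl)) ?_
    · exact compl_le_compl le_sup_left
    · exact compl_le_compl le_sup_right
    · rw [← compl_sup]
      exact compl_le_compl hbcd

/-! ### Frame homomorphisms induce functional morphisms -/

/-- Pseudocomplements need not be preserved, but `g a* ≤ (g a)*` always holds, and this inequality
is enough to transport the cover `a* ∨ b = 1`. -/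
theorem WellInside.map {L M : Type u} [Order.Frame L] [Order.Frame M] (g : FrameHom L M) {a b : L}
    (h : WellInside a b) : WellInside (g a) (g b) := by
  have hle : g aᶜ ≤ (g a)ᶜ := by
    rw [le_compl_iff_disjoint_left, disjoint_iff, ← map_inf, inf_compl_self, map_bot]
  refine top_le_iff.1 (le_trans ?_ (sup_le_sup_right hle (g b)))
  rw [← map_sup, show aᶜ ⊔ b = ⊤ from h, map_top]

theorem functional_regularMap {L M : KRFrmP.{u}} {f : L ⟶ M} (hf : isFrameHom f) :
    functional (X := M.regularAlgebra) (Y := L.regularAlgebra) (KRFrmP.regularMap f) := by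
  obtain ⟨g, hg⟩ := hf
  constructor
  · rintro (b : Heyting.Regular M.carrier) (b' : Heyting.Regular M.carrier)
      ⟨(a : Heyting.Regular L.carrier), hba, hab'⟩
    replace hba : WellInside b.val (PreframeHom.toFun f a.val) := hba
    replace hab' : WellInside b'.valᶜ (PreframeHom.toFun f a.valᶜ) := hab'
    change WellInside b.val b'.val
    rw [← hg] at hba hab'
    have hle : g a.val ≤ (g a.valᶜ)ᶜ := by
      rw [le_compl_iff_disjoint_left, disjoint_iff, ← map_inf, inf_comm, inf_compl_self, map_bot]
    -- Contraposing `b'* ≺ g a*` gives `(g a*)* ≺ b'**`. Now `b ≤ g a ≤ (g a*)*` on the left, and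
    -- `b'** = b'` on the right since `b'` is regular.
    exact (hab'.compl.mono (hba.le.trans hle) le_rfl).mono le_rfl b'.2.eq.le
  · intro (a : Heyting.Regular L.carrier) (a' : Heyting.Regular L.carrier) (h : WellInside a.val a'.val)
    obtain ⟨c, hac, hca'⟩ := KRFrmP.exists_between h
    -- The natural witness is the image of an interpolant `a ≺ c ≺ a'`; since `g c` need not be
    -- regular, its double pseudocomplement is taken.
    refine ⟨(⟨(g c.val)ᶜᶜ, compl_compl_compl _⟩ : Heyting.Regular M.carrier), ?_, ?_⟩
    · change WellInside (g c.val)ᶜᶜᶜ (PreframeHom.toFun f a.valᶜ)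
      -- The goal becomes `g a* ∨ (g c)** = 1`; enlarging `g c` to `(g c)**` is harmless, and `g a*
      -- ∨ g c = g (a* ∨ c) = 1`.
      rw [← hg, compl_compl_compl, WellInside, sup_comm]
      refine top_le_iff.1 (le_trans ?_ (sup_le_sup_left le_compl_compl _))
      rw [← map_sup, show a.valᶜ ⊔ c.val = ⊤ from hac, map_top]
    · change WellInside (g c.val)ᶜᶜ (PreframeHom.toFun f a'.val)
      rw [← hg]
      exact (hca'.map g).compl_compl

/-! ### Isomorphisms -/

/-- Identities are the relations `S₁` and `S₂`, so the two inverse laws read `T̂ ∘ T = S₁` and `T ∘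
T̂ = S₂`; being functional asks for one inclusion of each. -/
theorem functional_of_converse {B₁ B₂ : SubS5S.{u}} {T : CompatSub B₁ B₂}
    (h : T.comp T.converse = CompatSub.id B₁) (h' : T.converse.comp T = CompatSub.id B₂) :
    functional (X := B₁) (Y := B₂) T :=
  ⟨fun a a' => (congrFun₂ (congrArg CompatSub.rel h) a a').mp,
    fun b b' => (congrFun₂ (congrArg CompatSub.rel h') b b').mpr⟩

theorem CompatSub.converse_converse {B₁ B₂ : SubS5S.{u}} (T : CompatSub B₁ B₂) :
    T.converse.converse = T := by
  apply CompatSub.ext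
  ext a b
  simp [converse, hat]

theorem functional_unitHom (B : SubS5S.{u}) :
    functional (X := B) (RoundIdeal.unitHom B) :=
  functional_of_converse (RoundIdeal.unitHom_converse B) (RoundIdeal.converse_unitHom B)

/-- Because `T ↦ T̂` is an involution, passing to the inverse merely exchanges the two inverse laws.
-/
theorem functional_converse_unitHom (B : SubS5S.{u}) :
    functional (Y := B) (RoundIdeal.unitHom B).converse :=
  functional_of_converse
    (by rw [CompatSub.converse_converse]; exact RoundIdeal.converse_unitHom B)
    (by rw [CompatSub.converse_converse]; exact RoundIdeal.unitHom_converse B)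

theorem isFrameHom_isoOfOrderIso_hom {L M : KRFrmP.{u}} (e : L.carrier ≃o M.carrier) :
    isFrameHom (KRFrmP.isoOfOrderIso e).hom :=
  ⟨{ toFun := e
     map_inf' := e.map_inf
     map_top' := e.map_top
     map_sSup' := fun s => by rw [e.map_sSup, sSup_image] }, fun _ => rfl⟩

theorem isFrameHom_isoOfOrderIso_inv {L M : KRFrmP.{u}} (e : L.carrier ≃o M.carrier) :
    isFrameHom (KRFrmP.isoOfOrderIso e).inv :=
  isFrameHom_isoOfOrderIso_hom e.symm

/-! ### Restricting dual equivalences -/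

/-- A dual equivalence restricts to wide subcategories as soon as its functors and the components
of its natural isomorphisms and their inverses respect the given morphism properties. -/
theorem exists_restrictsTo {C D : Type (u + 1)} [Category.{u} C] [Category.{u} D] (e : C ≌ Dᵒᵖ)
    (P : MorphismProperty C) (Q : MorphismProperty D) [P.IsMultiplicative] [Q.IsMultiplicative]
    (hF : ∀ {X Y : C} (f : X ⟶ Y), P f → Q (e.functor.map f).unop)
    (hG : ∀ {X Y : D} (f : X ⟶ Y), Q f → P (e.inverse.map f.op))
    (unit_hom : ∀ X, P (e.unitIso.hom.app X)) (unit_inv : ∀ X, P (e.unitIso.inv.app X))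
    (counit_hom : ∀ Y, Q (e.counitIso.hom.app Y).unop)
    (counit_inv : ∀ Y, Q (e.counitIso.inv.app Y).unop) :
    ∃ e' : WideSubcategory P ≌ (WideSubcategory Q)ᵒᵖ, RestrictsTo e P Q e' := by
  -- Objects and underlying morphisms are taken from `e` without any transport, so that each clause
  -- of `RestrictsTo` holds by definition. Every law below is the corresponding law of `e`, since
  -- morphisms of a wide subcategory are equal when their underlying morphisms are.
  let F : WideSubcategory P ⥤ (WideSubcategory Q)ᵒᵖ :=
    { obj := fun X => Opposite.op ⟨(e.functor.obj X.obj).unop⟩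
      map := fun {X Y} f => Quiver.Hom.op
        (X := (⟨(e.functor.obj Y.obj).unop⟩ : WideSubcategory Q))
        (Y := (⟨(e.functor.obj X.obj).unop⟩ : WideSubcategory Q))
        ⟨(e.functor.map f.hom).unop, hF f.hom f.property⟩
      map_id := fun X => Quiver.Hom.unop_inj (WideSubcategory.hom_ext _
        (congrArg Quiver.Hom.unop (e.functor.map_id X.obj)))
      map_comp := fun f g => Quiver.Hom.unop_inj (WideSubcategory.hom_ext _
        (congrArg Quiver.Hom.unop (e.functor.map_comp f.hom g.hom))) }
  let G : (WideSubcategory Q)ᵒᵖ ⥤ WideSubcategory P :=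
    { obj := fun Y => ⟨e.inverse.obj (Opposite.op Y.unop.obj)⟩
      map := fun f => ⟨e.inverse.map f.unop.hom.op, hG f.unop.hom f.unop.property⟩
      map_id := fun Y => WideSubcategory.hom_ext _ (e.inverse.map_id (Opposite.op Y.unop.obj))
      map_comp := fun f g => WideSubcategory.hom_ext _
        (e.inverse.map_comp f.unop.hom.op g.unop.hom.op) }
  let η : 𝟭 (WideSubcategory P) ≅ F ⋙ G := NatIso.ofComponents
    (fun X => WideSubcategory.isoMk (Y := (F ⋙ G).obj X) (e.unitIso.app X.obj)
      (unit_hom X.obj) (unit_inv X.obj))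
    (fun f => WideSubcategory.hom_ext _ (e.unitIso.hom.naturality f.hom))
  -- The component is built in the wide subcategory of `D`, where it points from `Y` to its image
  -- under the round trip, and only then reversed.
  let ε : G ⋙ F ≅ 𝟭 (WideSubcategory Q)ᵒᵖ := NatIso.ofComponents
    (fun Y => (WideSubcategory.isoMk (X := Y.unop) (Y := ((G ⋙ F).obj Y).unop)
      (e.counitIso.app (Opposite.op Y.unop.obj)).unop
      (counit_hom (Opposite.op Y.unop.obj)) (counit_inv (Opposite.op Y.unop.obj))).op)
    (fun f => Quiver.Hom.unop_inj (WideSubcategory.hom_ext _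
      (congrArg Quiver.Hom.unop (e.counitIso.hom.naturality f.unop.hom.op))))
  exact ⟨
    { functor := F
      inverse := G
      unitIso := η
      counitIso := ε
      functor_unitIso_comp := fun X => Quiver.Hom.unop_inj (WideSubcategory.hom_ext _
        (congrArg Quiver.Hom.unop (e.functor_unitIso_comp X.obj))) },
    { functor_eq := rfl
      inverse_eq := rfl
      unit_heq := fun _ => HEq.rfl
      counit_heq := fun _ => HEq.rfl }⟩

theorem theoremt :
    (∃ e : SubS5F.{u} ≌ KRFrm.{u}ᵒᵖ,
      RestrictsTo dualEquivalenceSubS5S.{u} functional isFrameHom e) ∧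
    (∃ e : DeVF.{u} ≌ KRFrm.{u}ᵒᵖ,
      RestrictsTo dualEquivalenceDeVS.{u} (functional.inverseImage isDeVries.ι) isFrameHom e) :=
  ⟨exists_restrictsTo _ _ _ (fun _ hT => isFrameHom_roundIdealMap hT)
      (fun _ hf => functional_regularMap hf) functional_unitHom functional_converse_unitHom
      (fun _ => isFrameHom_isoOfOrderIso_hom _) (fun _ => isFrameHom_isoOfOrderIso_inv _),
    -- Being functional in the de Vries case is tested on the underlying morphisms, and there the
    -- functors and both natural isomorphisms agree with those of the first part.
    exists_restrictsTo _ _ _ (fun _ hT => isFrameHom_roundIdealMap hT)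
      (fun _ hf => functional_regularMap hf) (fun B => functional_unitHom B.obj)
      (fun B => functional_converse_unitHom B.obj)
      (fun _ => isFrameHom_isoOfOrderIso_hom _) (fun _ => isFrameHom_isoOfOrderIso_inv _)⟩
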